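/- Let $(T(t))_{t\in\mathbb R}$ be a uniformly bounded $C_0$-group on a (real or complex) Banach space $X$, with infinitesimal generator $(A,D(A))$, that is, $Ax=\lim_{t\to0}\frac{T(t)x-x}{t}$ for those $x$ for which the limit exists. Let $$T^{(g)}\Bigl(\tfrac14\Bigr)x:=\frac1{\sqrt\pi}\int_{-\infty}^{\infty}e^{-s^2}\,T(s)x\,ds,\qquad H_n(t):=(-1)^ne^{t^2}\frac{d^n}{dt^n}e^{-t^2},$$ $$T_m(t)x:=\sum_{n=0}^{m}\frac{1}{2^n\,n!}\,H_n(t)\,A^nT^{(g)}\Bigl(\tfrac14\Bigr)x,\qquad x\in X,\ t\in\mathbb R,\ m\ge 0,$$ where $T^{(g)}(\tfrac14)x\in D(A^n)$ for all $n\ge 0$ and $x\in X$. Then for each $t\in\mathbb R$ there are $m_0\in\mathbb N$ and constants $C_{t,p}$ $(p=2,3,\dots)$ such that, for all integers $m\ge m_0$ and $2\le p\le m+1$, $$\lVert T(t)x-T_m(t)x\rVert\le\frac{C_{t,p}}{m^{\frac p2-\frac{11}{12}}}\,\lVert A^px\rVert,\qquad x\in D(A^p).$$ Moreover, for every compact $K\subset\mathbb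 R$, the number $m_0$ and, for each $p$, the constant $C_{t,p}$ can be chosen the same for all $t\in K$; in particular, for $p\ge 2$ and $x\in D(A^p)$, $T_m(t)x\to T(t)x$ as $m\to\infty$ locally uniformly in $t\in\mathbb R$. -/

import Mathlib

open Filter Topology

namespace HermiteGroup

section Operators

variable {𝕜 X : Type*} [RCLike 𝕜] [NormedAddCommGroup X] [NormedSpace 𝕜 X]

/-- A `C₀`-group: a strongly continuous one-parameter family of bounded linear operators with
`T(0) = I` and `T(s + t) = T(s) T(t)`. -/
structure IsC0Group (T : ℝ → X →L[𝕜] X) : Prop where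
  map_zero : T 0 = ContinuousLinearMap.id 𝕜 X
  map_add : ∀ s t : ℝ, T (s + t) = (T s).comp (T t)
  continuous_orbit : ∀ x : X, Continuous fun t : ℝ => T t x

/-- Composition `g ∘ f` of unbounded operators, with the maximal domain
`{x ∈ D(f) | f x ∈ D(g)}`. -/
def pmapComp (g f : X →ₗ.[𝕜] X) : X →ₗ.[𝕜] X where
  domain :=
    { carrier := {x | ∃ h : x ∈ f.domain, f ⟨x, h⟩ ∈ g.domain}
      zero_mem' := ⟨f.domain.zero_mem, by
        have h : f ⟨0, f.domain.zero_mem⟩ = 0 := f.map_zero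
        rw [h]; exact g.domain.zero_mem⟩
      add_mem' := by
        rintro x y ⟨hx, hx'⟩ ⟨hy, hy'⟩
        refine ⟨f.domain.add_mem hx hy, ?_⟩
        have h : f ⟨x + y, f.domain.add_mem hx hy⟩ = f ⟨x, hx⟩ + f ⟨y, hy⟩ :=
          f.map_add ⟨x, hx⟩ ⟨y, hy⟩
        rw [h]; exact g.domain.add_mem hx' hy'
      smul_mem' := by
        rintro c x ⟨hx, hx'⟩
        refine ⟨f.domain.smul_mem c hx, ?_⟩
        have h : f ⟨c • x, f.domain.smul_mem c hx⟩ = c • f ⟨x, hx⟩ := f.map_smul c ⟨x, hx⟩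
        rw [h]; exact g.domain.smul_mem c hx' }
  toFun :=
    { toFun := fun x => g ⟨f ⟨x.1, x.2.choose⟩, x.2.choose_spec⟩
      map_add' := by
        intro x y
        rw [← g.map_add]
        congr 1
        apply Subtype.ext
        exact f.map_add ⟨x.1, x.2.choose⟩ ⟨y.1, y.2.choose⟩
      map_smul' := by
        intro c x
        rw [RingHom.id_apply, ← g.map_smul]
        congr 1
        apply Subtype.ext
        exact f.map_smul c ⟨x.1, x.2.choose⟩ }

/-- Powers of an unbounded operator: `A⁰ = I` on all of `X` and `Aⁿ⁺¹ = A ∘ Aⁿ` with domain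
`{x ∈ D(Aⁿ) | Aⁿ x ∈ D(A)}`. -/
def pmapPow (A : X →ₗ.[𝕜] X) : ℕ → X →ₗ.[𝕜] X
  | 0 => LinearMap.toPMap LinearMap.id ⊤
  | n + 1 => pmapComp A (pmapPow A n)

open Classical in
/-- The value of an unbounded operator at a vector, set to `0` outside the domain. -/
noncomputable def pmapEval (A : X →ₗ.[𝕜] X) (x : X) : X :=
  if h : x ∈ A.domain then A ⟨x, h⟩ else 0

end Operators

section Generator

variable {𝕜 X : Type*} [RCLike 𝕜] [NormedAddCommGroup X] [NormedSpace ℝ X] [NormedSpace 𝕜 X]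
  [IsScalarTower ℝ 𝕜 X]

/-- The infinitesimal generator `A x = lim_{t → 0} (T(t) x - x) / t`, defined for those `x` for
which the (two-sided) limit exists. -/
noncomputable def generator (T : ℝ → X →L[𝕜] X) : X →ₗ.[𝕜] X where
  domain :=
    { carrier := {x | ∃ y, Tendsto (fun t : ℝ => t⁻¹ • (T t x - x)) (𝓝[≠] 0) (𝓝 y)}
      zero_mem' := ⟨0, by simp⟩
      add_mem' := by
        rintro x y ⟨x', hx⟩ ⟨y', hy⟩
        refine ⟨x' + y', (hx.add hy).congr fun t => ?_⟩
        rw [← smul_add, map_add]; congr 1; abel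
      smul_mem' := by
        rintro c x ⟨x', hx⟩
        refine ⟨c • x', (hx.const_smul c).congr fun t => ?_⟩
        rw [map_smul, ← smul_sub, smul_comm] }
  toFun :=
    { toFun := fun x => x.2.choose
      map_add' := by
        intro x y
        refine tendsto_nhds_unique (x + y).2.choose_spec
          ((x.2.choose_spec.add y.2.choose_spec).congr fun t => ?_)
        rw [← smul_add, Submodule.coe_add, map_add]; congr 1; abel
      map_smul' := by
        intro c x
        refine tendsto_nhds_unique (c • x).2.choose_spec
          ((x.2.choose_spec.const_smul c).congr fun t => ?_)
        rw [Submodule.coe_smul, map_smul, ← smul_sub, smul_comm] }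

/-- The semigroup subordinated to `T` by the Gaussian kernel,
`T^{(g)}(s) x = (4 π s)^{-1/2} ∫ e^{-t² / (4 s)} T(t) x dt`, for real `s > 0`. -/
noncomputable def gaussSemigroup (T : ℝ → X →L[𝕜] X) (s : ℝ) (x : X) : X :=
  (1 / Real.sqrt (4 * Real.pi * s)) • ∫ t : ℝ, Real.exp (-t ^ 2 / (4 * s)) • T t x

/-- The classical (physicists') Hermite polynomials, by Rodrigues' formula
`Hₙ(t) = (-1)ⁿ e^{t²} (dⁿ/dtⁿ) e^{-t²}`. -/
noncomputable def hermiteH (n : ℕ) (t : ℝ) : ℝ :=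
  (-1) ^ n * Real.exp (t ^ 2) * iteratedDeriv n (fun s : ℝ => Real.exp (-s ^ 2)) t

/-- The partial sum
`T_m(t) x = ∑_{n = 0}^{m} (1 / (2ⁿ n!)) Hₙ(t) Aⁿ T^{(g)}(1/4) x`,
where `A` is the generator of `T`. -/
noncomputable def hermiteSum (T : ℝ → X →L[𝕜] X) (m : ℕ) (t : ℝ) (x : X) : X :=
  ∑ n ∈ Finset.range (m + 1), (1 / (2 ^ n * (n.factorial : ℝ)) * hermiteH n t) •
    pmapEval (pmapPow (generator T) n) (gaussSemigroup T (1 / 4) x)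

end Generator

end HermiteGroup

/-! Write `w_n(s) = H_n(s) e^{-s²}`. Since the generator raises the index of `∫ w_n(s) T(s)x ds` by
one, `T_m(t)x` is the partial Hermite sum, at `t`, of the orbit `s ↦ T(s)x`. Dilate the orbit about
`t` to `s ↦ T(t + u(s - t))x` and let `dilatedSum` be its partial sum at `t`. For `u = 0` the
function is constant and the sum is exactly `T(t)x`; for `u = 1` it is `T_m(t)x`. The error is thus
controlled by the `u`-derivative on `[0, 1]`.

Differentiating brings out a factor `s - t`, and `christoffel_darboux` collapses the sum to two
integrals of `T(t + u(s - t))Ax`, against `w_m` and `w_{m+1}` (`hasDerivAt_dilatedSum`). Integrating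
by parts `r = p - 1` times lowers both indices by `r` and turns `Ax` into `A^p x`. Cauchy–Schwarz
gives `∫ |w_n| ≤ √(2^n n! π)`, and a Sonin-type monotonicity argument gives `|H_n(t)| ≲ e^{t²} √(2^n
n!) n^{-1/4}`. Together the rate is `m^{3/4 - p/2}`, stronger than the required `m^{11/12 - p/2}`.
-/

namespace HermiteGroup

/-! ### Algebra of Hermite polynomials -/

open Polynomial MeasureTheory

/-- The physicists' Hermite polynomials, by the recursion `Hₙ₊₁ = 2 X Hₙ - Hₙ'`. -/
noncomputable def hermitePoly : ℕ → ℝ[X]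
  | 0 => 1
  | n + 1 => 2 * X * hermitePoly n - derivative (hermitePoly n)

theorem derivative_hermitePoly_succ (n : ℕ) :
    derivative (hermitePoly (n + 1)) = 2 * ((n : ℝ[X]) + 1) * hermitePoly n := by
  induction n with
  | zero => simp [hermitePoly]
  | succ n ih =>
    rw [hermitePoly, derivative_sub, ih]
    have h : derivative (2 * ((n : ℝ[X]) + 1) * hermitePoly n) =
        2 * ((n : ℝ[X]) + 1) * derivative (hermitePoly n) := by
      simp [derivative_mul]
    rw [h, derivative_mul, ih, hermitePoly]
    simp [derivative_mul]
    ring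

theorem hermitePoly_eval_add_two (n : ℕ) (x : ℝ) :
    (hermitePoly (n + 2)).eval x =
      2 * x * (hermitePoly (n + 1)).eval x - 2 * (n + 1) * (hermitePoly n).eval x := by
  rw [hermitePoly, derivative_hermitePoly_succ]
  simp

theorem hasDerivAt_hermitePoly_succ (n : ℕ) (x : ℝ) :
    HasDerivAt (fun s => (hermitePoly (n + 1)).eval s)
      (2 * (n + 1) * (hermitePoly n).eval x) x := by
  have h := (hermitePoly (n + 1)).hasDerivAt x
  rw [derivative_hermitePoly_succ] at h
  simpa using h

theorem hasDerivAt_hermitePoly (n : ℕ) (x : ℝ) :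
    HasDerivAt (fun s => (hermitePoly n).eval s)
      (2 * x * (hermitePoly n).eval x - (hermitePoly (n + 1)).eval x) x := by
  refine ((hermitePoly n).hasDerivAt x).congr_deriv ?_
  simp [hermitePoly]

/-- The functions `Hₙ(s) e^{-s²}`. -/
noncomputable def hermiteWeight (n : ℕ) (s : ℝ) : ℝ := (hermitePoly n).eval s * Real.exp (-s ^ 2)

theorem hasDerivAt_hermiteWeight (n : ℕ) (x : ℝ) :
    HasDerivAt (hermiteWeight n) (-hermiteWeight (n + 1) x) x := by
  have h1 : HasDerivAt (fun s : ℝ => Real.exp (-s ^ 2)) (Real.exp (-x ^ 2) * -(2 * x)) x := by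
    simpa using ((hasDerivAt_pow 2 x).neg).exp
  refine ((hasDerivAt_hermitePoly n x).mul h1).congr_deriv ?_
  simp only [hermiteWeight]
  ring

theorem continuous_hermiteWeight (n : ℕ) : Continuous (hermiteWeight n) :=
  continuous_iff_continuousAt.2 fun x => (hasDerivAt_hermiteWeight n x).continuousAt

theorem iteratedDeriv_gaussian (n : ℕ) :
    iteratedDeriv n (fun s : ℝ => Real.exp (-s ^ 2)) = fun s => (-1) ^ n * hermiteWeight n s := by
  induction n with
  | zero => ext s; simp [hermiteWeight, hermitePoly]
  | succ n ih =>
    rw [iteratedDeriv_succ, ih]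
    ext s
    rw [((hasDerivAt_hermiteWeight n s).const_mul _).deriv]
    ring

theorem hermiteH_eq_eval (n : ℕ) (t : ℝ) : hermiteH n t = (hermitePoly n).eval t := by
  have h : Real.exp (t ^ 2) * Real.exp (-t ^ 2) = 1 := by rw [← Real.exp_add]; simp
  have h' : ((-1 : ℝ) ^ n) * (-1) ^ n = 1 := by rw [← mul_pow]; simp
  rw [hermiteH, iteratedDeriv_gaussian]
  simp only [hermiteWeight]
  linear_combination (eval t (hermitePoly n)) * (h' * (Real.exp (t ^ 2) * Real.exp (-t ^ 2)) + h)

/-- The Christoffel–Darboux identity for Hermite polynomials. -/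
theorem christoffel_darboux (m : ℕ) (t s : ℝ) :
    (∑ n ∈ Finset.range (m + 1),
      1 / (2 ^ n * (n.factorial : ℝ)) * (hermitePoly n).eval t * (hermitePoly n).eval s) * (s - t) =
    1 / (2 ^ (m + 1) * (m.factorial : ℝ)) * ((hermitePoly m).eval t * (hermitePoly (m + 1)).eval s -
      (hermitePoly (m + 1)).eval t * (hermitePoly m).eval s) := by
  induction m with
  | zero => simp [hermitePoly]; ring
  | succ m ih =>
    rw [Finset.sum_range_succ, add_mul, ih, hermitePoly_eval_add_two, hermitePoly_eval_add_two,
      Nat.factorial_succ]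
    have : (m.factorial : ℝ) ≠ 0 := by positivity
    push_cast
    field_simp
    ring

/-! ### Pointwise bounds -/

theorem sq_hermitePoly_eval_zero (n : ℕ) :
    ((hermitePoly n).eval 0) ^ 2 ≤ 2 ^ n * n.factorial / √(n + 1) := by
  induction n using Nat.twoStepInduction with
  | zero => simp [hermitePoly]
  | one =>
    have h : eval 0 (hermitePoly 1) = 0 := by simp [hermitePoly]
    rw [h, zero_pow two_ne_zero]
    positivity
  | more n ih _ =>
    rw [hermitePoly_eval_add_two]
    have e : (2 * 0 * eval 0 (hermitePoly (n + 1)) - 2 * (n + 1) * eval 0 (hermitePoly n)) ^ 2 =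
      4 * (n + 1) ^ 2 * (eval 0 (hermitePoly n)) ^ 2 := by ring
    rw [e]
    refine (mul_le_mul_of_nonneg_left ih (by positivity)).trans ?_
    have e2 : (2 : ℝ) ^ (n + 2) * ((n + 2).factorial : ℝ) / √((n + 2 : ℕ) + 1) =
        (2 ^ n * n.factorial) * (4 * (n + 1) * (n + 2) / √(n + 3)) := by
      rw [Nat.factorial_succ, Nat.factorial_succ]
      push_cast
      rw [show (n : ℝ) + 2 + 1 = n + 3 by ring]
      ring
    rw [e2, show 4 * ((n : ℝ) + 1) ^ 2 * (2 ^ n * n.factorial / √(n + 1)) =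
      (2 ^ n * n.factorial) * (4 * (n + 1) ^ 2 / √(n + 1)) by ring]
    refine mul_le_mul_of_nonneg_left ?_ (by positivity)
    rw [div_le_div_iff₀ (by positivity) (by positivity)]
    have h : ((n : ℝ) + 1) * √(n + 3) ≤ (n + 2) * √(n + 1) := by
      -- After squaring this is `(n + 1)(n + 3) ≤ (n + 2)²`.
      apply le_of_sq_le_sq _ (by positivity)
      rw [mul_pow, mul_pow, Real.sq_sqrt (by positivity), Real.sq_sqrt (by positivity)]
      have : (0 : ℝ) ≤ n := n.cast_nonneg
      nlinarith
    nlinarith [mul_le_mul_of_nonneg_left h (by positivity : (0 : ℝ) ≤ 4 * (n + 1))]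

/-- Sonin's function of a Hermite polynomial, damped so that it is maximal at the origin. -/
noncomputable def hermiteEnergy (n : ℕ) (x : ℝ) : ℝ :=
  (((hermitePoly (n + 1)).eval x) ^ 2 + 2 * (n + 1) * ((hermitePoly n).eval x) ^ 2) *
    Real.exp (-(2 * x ^ 2))

/-- The weight `2(n + 1)` cancels the cross terms `H_n H_{n+1}`, and the damping `e^{-2x²}` cancels
the remaining `x H_n²`; what is left has the sign of `-x`. -/
theorem hasDerivAt_hermiteEnergy (n : ℕ) (x : ℝ) :
    HasDerivAt (hermiteEnergy n)
      (x * -(4 * ((hermitePoly (n + 1)).eval x) ^ 2 * Real.exp (-(2 * x ^ 2)))) x := by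
  have h1 : HasDerivAt (fun s : ℝ => Real.exp (-(2 * s ^ 2)))
      (Real.exp (-(2 * x ^ 2)) * -(4 * x)) x := by
    refine (((hasDerivAt_pow 2 x).const_mul 2).neg.exp).congr_deriv ?_
    simp only [Pi.neg_apply]
    push_cast
    ring
  refine ((((hasDerivAt_hermitePoly_succ n x).pow 2).add
    (((hasDerivAt_hermitePoly n x).pow 2).const_mul (2 * ((n : ℝ) + 1)))).mul h1).congr_deriv ?_
  simp only [Pi.add_apply, Pi.pow_apply]
  push_cast
  ring

theorem hermiteEnergy_le (n : ℕ) (x : ℝ) : hermiteEnergy n x ≤ hermiteEnergy n 0 := by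
  have hc : Continuous (hermiteEnergy n) :=
    continuous_iff_continuousAt.2 fun x => (hasDerivAt_hermiteEnergy n x).continuousAt
  rcases le_total 0 x with hx | hx
  · refine antitoneOn_of_deriv_nonpos (convex_Ici 0) hc.continuousOn
      (fun y _ => (hasDerivAt_hermiteEnergy n y).differentiableAt.differentiableWithinAt)
      (fun y hy => ?_) Set.self_mem_Ici hx hx
    rw [interior_Ici] at hy
    rw [(hasDerivAt_hermiteEnergy n y).deriv]
    exact mul_nonpos_of_nonneg_of_nonpos (le_of_lt hy) (by rw [neg_nonpos]; positivity)
  · refine monotoneOn_of_deriv_nonneg (convex_Iic 0) hc.continuousOn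
      (fun y _ => (hasDerivAt_hermiteEnergy n y).differentiableAt.differentiableWithinAt)
      (fun y hy => ?_) hx Set.self_mem_Iic hx
    rw [interior_Iic] at hy
    rw [(hasDerivAt_hermiteEnergy n y).deriv]
    exact mul_nonneg_of_nonpos_of_nonpos (le_of_lt hy) (by rw [neg_nonpos]; positivity)

theorem sq_hermitePoly_add_sq_le (n : ℕ) (x : ℝ) :
    ((hermitePoly (n + 1)).eval x) ^ 2 + 2 * (n + 1) * ((hermitePoly n).eval x) ^ 2 ≤
      2 ^ (n + 1) * (n + 1).factorial * (2 * Real.exp (2 * x ^ 2) / √(n + 1)) := by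
  have h := hermiteEnergy_le n x
  rw [hermiteEnergy, hermiteEnergy, Real.exp_neg, ← div_eq_mul_inv,
    div_le_iff₀ (Real.exp_pos _)] at h
  refine h.trans ?_
  have h0 : ((hermitePoly (n + 1)).eval 0) ^ 2 ≤ 2 ^ (n + 1) * (n + 1).factorial / √(n + 1) := by
    refine (sq_hermitePoly_eval_zero (n + 1)).trans ?_
    gcongr
    simp
  have h1 : 2 * ((n : ℝ) + 1) * ((hermitePoly n).eval 0) ^ 2 ≤
      2 ^ (n + 1) * (n + 1).factorial / √(n + 1) := by
    refine (mul_le_mul_of_nonneg_left (sq_hermitePoly_eval_zero n) (by positivity)).trans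
      (le_of_eq ?_)
    rw [Nat.factorial_succ]
    push_cast
    ring
  have h2 := mul_le_mul_of_nonneg_right (add_le_add h0 h1) (Real.exp_pos (2 * x ^ 2)).le
  simp only [ne_eq, OfNat.ofNat_ne_zero, not_false_eq_true, zero_pow, mul_zero, neg_zero,
    Real.exp_zero, mul_one]
  refine h2.trans (le_of_eq ?_)
  ring

theorem sq_hermitePoly_le (n : ℕ) (x : ℝ) :
    ((hermitePoly n).eval x) ^ 2 ≤
      2 ^ n * n.factorial * (2 * Real.exp (2 * x ^ 2) / √(n + 1)) := by
  have h := sq_hermitePoly_add_sq_le n x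
  have h' : 2 * ((n : ℝ) + 1) * ((hermitePoly n).eval x) ^ 2 ≤
      2 * ((n : ℝ) + 1) * (2 ^ n * n.factorial * (2 * Real.exp (2 * x ^ 2) / √(n + 1))) := by
    rw [Nat.factorial_succ] at h
    push_cast at h
    refine le_trans (by nlinarith [sq_nonneg ((hermitePoly (n + 1)).eval x)])
      (h.trans (le_of_eq (by ring)))
  exact le_of_mul_le_mul_left h' (by positivity)

theorem sq_hermitePoly_succ_le (n : ℕ) (x : ℝ) :
    ((hermitePoly (n + 1)).eval x) ^ 2 ≤
      2 ^ (n + 1) * (n + 1).factorial * (2 * Real.exp (2 * x ^ 2) / √(n + 1)) := by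
  refine le_trans ?_ (sq_hermitePoly_add_sq_le n x)
  have : 0 ≤ 2 * ((n : ℝ) + 1) * ((hermitePoly n).eval x) ^ 2 := by positivity
  linarith

/-! ### Gaussian integrals -/

/-- From `|s|^n ≤ n! e^{|s|}` and `|s| ≤ s²/2 + 1/2`. Half of the Gaussian is left over for
integrability. -/
theorem exists_abs_eval_le_exp (P : ℝ[X]) :
    ∃ C, 0 ≤ C ∧ ∀ s : ℝ, |P.eval s| ≤ C * Real.exp (s ^ 2 / 2) := by
  induction P using Polynomial.induction_on' with
  | add p q hp hq =>
    obtain ⟨C, hC, h⟩ := hp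
    obtain ⟨D, hD, h'⟩ := hq
    refine ⟨C + D, by positivity, fun s => ?_⟩
    rw [eval_add, add_mul]
    exact (abs_add_le _ _).trans (add_le_add (h s) (h' s))
  | monomial n a =>
    refine ⟨|a| * (n.factorial * Real.exp (1 / 2)), by positivity, fun s => ?_⟩
    rw [eval_monomial, abs_mul, abs_pow, mul_assoc, mul_assoc, ← Real.exp_add]
    refine mul_le_mul_of_nonneg_left ?_ (abs_nonneg a)
    have h := Real.pow_div_factorial_le_exp |s| (abs_nonneg s) n
    rw [div_le_iff₀ (by positivity), mul_comm] at h
    refine h.trans (mul_le_mul_of_nonneg_left (Real.exp_le_exp.2 ?_) (by positivity))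
    nlinarith [sq_nonneg (|s| - 1), sq_abs s]

theorem integrable_exp_neg_sq_div (c : ℝ) (hc : 0 < c) :
    Integrable fun s : ℝ => Real.exp (-s ^ 2 / c) := by
  refine (integrable_exp_neg_mul_sq (inv_pos.2 hc)).congr (ae_of_all _ fun s => ?_)
  simp only
  congr 1
  ring

theorem integrable_eval_mul_gaussian (P : ℝ[X]) :
    Integrable fun s : ℝ => P.eval s * Real.exp (-s ^ 2) := by
  obtain ⟨C, -, hC⟩ := exists_abs_eval_le_exp P
  refine ((integrable_exp_neg_sq_div 2 two_pos).const_mul C).mono'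
    (by fun_prop) (ae_of_all _ fun s => ?_)
  rw [norm_mul, Real.norm_eq_abs, Real.norm_eq_abs, abs_of_pos (Real.exp_pos _)]
  refine (mul_le_mul_of_nonneg_right (hC s) (Real.exp_pos _).le).trans (le_of_eq ?_)
  rw [mul_assoc, ← Real.exp_add]
  ring_nf

theorem integrable_hermiteWeight (n : ℕ) : Integrable (hermiteWeight n) :=
  integrable_eval_mul_gaussian (hermitePoly n)

/-- A majorant uniform over small translations, for differentiating `∫ w_n(s - h) T(s)x ds` at `h =
0`. It rests on `(s - h)²/2 ≥ s²/4 - 1/2` for `|h| ≤ 1`. -/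
theorem exists_abs_hermiteWeight_sub_le (n : ℕ) :
    ∃ g : ℝ → ℝ, Integrable g ∧ ∀ s h : ℝ, |h| ≤ 1 → |hermiteWeight n (s - h)| ≤ g s := by
  obtain ⟨C, hC0, hC⟩ := exists_abs_eval_le_exp (hermitePoly n)
  refine ⟨_, (integrable_exp_neg_sq_div 4 four_pos).const_mul (C * Real.exp (1 / 2)), ?_⟩
  intro s h hh
  rw [hermiteWeight, abs_mul, abs_of_pos (Real.exp_pos _)]
  refine (mul_le_mul_of_nonneg_right (hC _) (Real.exp_pos _).le).trans ?_
  rw [mul_assoc, mul_assoc, ← Real.exp_add, ← Real.exp_add]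
  refine mul_le_mul_of_nonneg_left (Real.exp_le_exp.2 ?_) hC0
  have : h ^ 2 ≤ 1 := by rw [← sq_abs]; nlinarith [abs_nonneg h]
  nlinarith [sq_nonneg (s - 2 * h)]

/-! ### Integration by parts and norms of the Hermite weights -/

section Parts

variable {X : Type*} [NormedAddCommGroup X] [NormedSpace ℝ X]

theorem integral_hermiteWeight_succ_smul [CompleteSpace X] (n : ℕ) {F F' : ℝ → X}
    (hF : ∀ s, HasDerivAt F (F' s) s)
    (h0 : Integrable fun s => hermiteWeight n s • F s)
    (h1 : Integrable fun s => hermiteWeight (n + 1) s • F s)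
    (h2 : Integrable fun s => hermiteWeight n s • F' s) :
    ∫ s, hermiteWeight (n + 1) s • F s = ∫ s, hermiteWeight n s • F' s := by
  have h := integral_eq_zero_of_hasDerivAt_of_integrable
    (fun s => (hasDerivAt_hermiteWeight n s).smul (hF s)) (h2.add (by simpa using h1.neg)) h0
  rw [integral_add h2 (by simpa using h1.neg)] at h
  simp only [neg_smul, integral_neg] at h
  rw [← sub_eq_add_neg, sub_eq_zero] at h
  exact h.symm

theorem integrable_hermiteWeight_smul_of_bounded (n : ℕ) {F : ℝ → X} (hF : Continuous F) {B : ℝ}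
    (hB : ∀ s, ‖F s‖ ≤ B) : Integrable fun s => hermiteWeight n s • F s :=
  (integrable_hermiteWeight n).smul_bdd B hF.aestronglyMeasurable (ae_of_all _ hB)

end Parts

theorem integral_hermiteWeight_zero : ∫ s, hermiteWeight 0 s = √Real.pi := by
  simpa [hermiteWeight, hermitePoly] using integral_gaussian 1

theorem integral_hermiteWeight_succ (n : ℕ) : ∫ s, hermiteWeight (n + 1) s = 0 := by
  have h := integral_hermiteWeight_succ_smul n (F := fun _ => (1 : ℝ)) (F' := fun _ => 0)
    (fun s => hasDerivAt_const s 1) (by simpa using integrable_hermiteWeight n)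
    (by simpa using integrable_hermiteWeight (n + 1)) (by simp)
  simpa using h

theorem integrable_hermiteWeight_mul_eval (n : ℕ) (P : ℝ[X]) :
    Integrable fun s => hermiteWeight n s * P.eval s := by
  refine (integrable_eval_mul_gaussian (hermitePoly n * P)).congr (ae_of_all _ fun s => ?_)
  simp only [hermiteWeight, eval_mul]
  ring

theorem integral_hermiteWeight_mul_self (n : ℕ) :
    ∫ s, hermiteWeight n s * (hermitePoly n).eval s = 2 ^ n * n.factorial * √Real.pi := by
  induction n with
  | zero => simpa [hermitePoly] using integral_hermiteWeight_zero
  | succ n ih =>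
    have h := integral_hermiteWeight_succ_smul n (hasDerivAt_hermitePoly_succ n)
      (integrable_hermiteWeight_mul_eval n _) (integrable_hermiteWeight_mul_eval (n + 1) _)
      (by
        refine ((integrable_hermiteWeight_mul_eval n (hermitePoly n)).const_mul
          (2 * ((n : ℝ) + 1))).congr (ae_of_all _ fun s => ?_)
        simp only [smul_eq_mul]
        ring)
    simp only [smul_eq_mul] at h
    rw [h]
    simp only [mul_left_comm _ (2 * ((n : ℝ) + 1)) _]
    rw [integral_const_mul, ih, Nat.factorial_succ]
    push_cast
    ring

/-- Cauchy–Schwarz against the Gaussian, in the pointwise form `|a| ≤ a²/(2c) + c/2`; taking `c² =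
2^n n!` makes the two halves contribute equally. -/
theorem integral_abs_hermiteWeight_le (n : ℕ) :
    ∫ s, |hermiteWeight n s| ≤ √(2 ^ n * n.factorial) * √Real.pi := by
  set c := √(2 ^ n * (n.factorial : ℝ)) with hc
  have hc0 : 0 < c := Real.sqrt_pos.2 (by positivity)
  have hc2 : c ^ 2 = 2 ^ n * n.factorial := Real.sq_sqrt (by positivity)
  have i1 := (integrable_hermiteWeight_mul_eval n (hermitePoly n)).const_mul (1 / (2 * c))
  have i2 := (integrable_hermiteWeight 0).const_mul (c / 2)
  calc ∫ s, |hermiteWeight n s| ≤ ∫ s, (1 / (2 * c) * (hermiteWeight n s * (hermitePoly n).eval s)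
        + c / 2 * hermiteWeight 0 s) := by
        refine integral_mono (integrable_hermiteWeight n).abs (i1.add i2) fun s => ?_
        simp only [hermiteWeight, hermitePoly, eval_one, one_mul, abs_mul,
          abs_of_pos (Real.exp_pos _)]
        set a := eval s (hermitePoly n)
        have h : |a| ≤ 1 / (2 * c) * (a * a) + c / 2 := by
          rw [← sub_nonneg, show 1 / (2 * c) * (a * a) + c / 2 - |a| =
            1 / (2 * c) * (|a| - c) ^ 2 by rw [sub_sq, sq_abs]; field_simp; ring]
          positivity
        calc _ ≤ (1 / (2 * c) * (a * a) + c / 2) * Real.exp (-s ^ 2) :=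
              mul_le_mul_of_nonneg_right h (Real.exp_pos _).le
          _ = _ := by ring
    _ = c * √Real.pi := by
        rw [integral_add i1 i2, integral_const_mul, integral_const_mul,
          integral_hermiteWeight_mul_self, integral_hermiteWeight_zero, ← hc2]
        field_simp
        ring

/-! ### Domains and values of powers of an operator -/

section Powers

variable {𝕜 X : Type*} [RCLike 𝕜] [NormedAddCommGroup X] [NormedSpace 𝕜 X]

theorem pmapEval_of_mem {A : X →ₗ.[𝕜] X} {x : X} (h : x ∈ A.domain) : pmapEval A x = A ⟨x, h⟩ :=
  dif_pos h

theorem mem_domain_pmapPow_succ_iff {A : X →ₗ.[𝕜] X} {n : ℕ} {x : X} :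
    x ∈ (pmapPow A (n + 1)).domain ↔
      x ∈ (pmapPow A n).domain ∧ pmapEval (pmapPow A n) x ∈ A.domain := by
  constructor
  · rintro ⟨h, h'⟩
    exact ⟨h, by rwa [pmapEval_of_mem h]⟩
  · rintro ⟨h, h'⟩
    exact ⟨h, by rwa [pmapEval_of_mem h] at h'⟩

theorem pmapEval_pmapPow_zero (A : X →ₗ.[𝕜] X) (x : X) : pmapEval (pmapPow A 0) x = x :=
  pmapEval_of_mem (A := pmapPow A 0) (Submodule.mem_top : x ∈ (⊤ : Submodule 𝕜 X))

theorem pmapEval_pmapPow_succ {A : X →ₗ.[𝕜] X} {n : ℕ} {x : X}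
    (h : x ∈ (pmapPow A (n + 1)).domain) :
    pmapEval (pmapPow A (n + 1)) x = pmapEval A (pmapEval (pmapPow A n) x) := by
  have h' := mem_domain_pmapPow_succ_iff.1 h
  rw [pmapEval_of_mem h, pmapEval_of_mem h'.2]
  change A ⟨pmapPow A n ⟨x, _⟩, _⟩ = A _
  congr 1
  exact Subtype.ext (pmapEval_of_mem h'.1).symm

theorem mem_domain_pmapPow_of_le {A : X →ₗ.[𝕜] X} {n k : ℕ} (hk : k ≤ n) {x : X}
    (h : x ∈ (pmapPow A n).domain) : x ∈ (pmapPow A k).domain := by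
  induction n, hk using Nat.le_induction with
  | base => exact h
  | succ n _ ih => exact ih (mem_domain_pmapPow_succ_iff.1 h).1

theorem norm_apply_le {T : ℝ → X →L[𝕜] X} {M : ℝ} (hM : ∀ t : ℝ, ‖T t‖ ≤ M) (t : ℝ) (x : X) :
    ‖T t x‖ ≤ M * ‖x‖ :=
  (T t).le_of_opNorm_le (hM t) x

theorem norm_integral_hermiteWeight_smul_le [NormedSpace ℝ X] {T : ℝ → X →L[𝕜] X} {M : ℝ}
    (hM : ∀ t : ℝ, ‖T t‖ ≤ M) (n : ℕ) (f : ℝ → ℝ)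
    (x : X) : ‖∫ s, hermiteWeight n s • T (f s) x‖ ≤
      √(2 ^ n * n.factorial) * √Real.pi * (M * ‖x‖) := by
  have hM0 : 0 ≤ M := (norm_nonneg _).trans (hM 0)
  refine (norm_integral_le_of_norm_le ((integrable_hermiteWeight n).abs.mul_const (M * ‖x‖))
    (ae_of_all _ fun s => ?_)).trans ?_
  · rw [norm_smul]
    exact mul_le_mul_of_nonneg_left (norm_apply_le hM _ x) (abs_nonneg _)
  · rw [integral_mul_const]
    exact mul_le_mul_of_nonneg_right (integral_abs_hermiteWeight_le n) (by positivity)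

end Powers

/-! ### Dilated Hermite sums -/

section Averages

variable {𝕜 X : Type*} [RCLike 𝕜] [NormedAddCommGroup X] [NormedSpace ℝ X] [NormedSpace 𝕜 X]
  {T : ℝ → X →L[𝕜] X}

theorem IsC0Group.integrable_hermiteWeight_smul (hT : IsC0Group T) {M : ℝ}
    (hM : ∀ t : ℝ, ‖T t‖ ≤ M) (n : ℕ) {f : ℝ → ℝ} (hf : Continuous f) (x : X) :
    Integrable fun s => hermiteWeight n s • T (f s) x :=
  integrable_hermiteWeight_smul_of_bounded n ((hT.continuous_orbit x).comp hf)
    fun s => norm_apply_le hM (f s) x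

theorem gaussSemigroup_quarter (T : ℝ → X →L[𝕜] X) (x : X) :
    gaussSemigroup T (1 / 4) x = (√Real.pi)⁻¹ • ∫ s, hermiteWeight 0 s • T s x := by
  simp only [gaussSemigroup, hermiteWeight, hermitePoly, eval_one, one_mul]
  rw [show 4 * Real.pi * (1 / 4) = Real.pi by ring, one_div]
  norm_num

/-- The partial sum of the Hermite expansion at `t` of the orbit dilated by `u` about `t`. -/
noncomputable def dilatedSum (T : ℝ → X →L[𝕜] X) (m : ℕ) (t : ℝ) (x : X) (u : ℝ) : X :=
  (√Real.pi)⁻¹ • ∑ n ∈ Finset.range (m + 1),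
    (1 / (2 ^ n * (n.factorial : ℝ)) * (hermitePoly n).eval t) •
      ∫ s, hermiteWeight n s • T (t + u * (s - t)) x

variable [CompleteSpace X]

theorem integral_hermiteWeight_smul_const (n : ℕ) (x : X) :
    ∫ s, hermiteWeight n s • x = (if n = 0 then √Real.pi else 0) • x := by
  rw [integral_smul_const]
  cases n with
  | zero => simp [integral_hermiteWeight_zero]
  | succ n => simp [integral_hermiteWeight_succ]

/-- At `u = 0` the orbit is frozen at `T(t)x`, and orthogonality of `H_n` to constants kills every
term with `n ≥ 1`. -/
theorem dilatedSum_zero (T : ℝ → X →L[𝕜] X) (m : ℕ) (t : ℝ) (x : X) :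
    dilatedSum T m t x 0 = T t x := by
  have h : √Real.pi ≠ 0 := (Real.sqrt_pos.2 Real.pi_pos).ne'
  rw [dilatedSum]
  simp only [zero_mul, add_zero, integral_hermiteWeight_smul_const]
  rw [Finset.sum_eq_single 0 (fun n _ hn => by simp [hn]) (by simp)]
  simp [hermitePoly, smul_smul, h]

end Averages

/-! ### Orbits, the generator, and the derivative in the dilation parameter -/

section Orbits

variable {𝕜 X : Type*} [RCLike 𝕜] [NormedAddCommGroup X] [NormedSpace ℝ X] [NormedSpace 𝕜 X]
  [IsScalarTower ℝ 𝕜 X] {T : ℝ → X →L[𝕜] X}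

theorem mem_domain_generator_of_tendsto {x y : X}
    (h : Tendsto (fun t : ℝ => t⁻¹ • (T t x - x)) (𝓝[≠] 0) (𝓝 y)) :
    x ∈ (generator T).domain := ⟨y, h⟩

theorem tendsto_generator {x : X} (h : x ∈ (generator T).domain) :
    Tendsto (fun t : ℝ => t⁻¹ • (T t x - x)) (𝓝[≠] 0) (𝓝 (pmapEval (generator T) x)) := by
  rw [pmapEval_of_mem h]
  exact Exists.choose_spec h

theorem pmapEval_generator_of_tendsto {x y : X}
    (h : Tendsto (fun t : ℝ => t⁻¹ • (T t x - x)) (𝓝[≠] 0) (𝓝 y)) :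
    pmapEval (generator T) x = y :=
  tendsto_nhds_unique (tendsto_generator (mem_domain_generator_of_tendsto h)) h

theorem IsC0Group.hasDerivAt_orbit (hT : IsC0Group T) {x : X} (h : x ∈ (generator T).domain)
    (s : ℝ) : HasDerivAt (fun t => T t x) (T s (pmapEval (generator T) x)) s := by
  rw [hasDerivAt_iff_tendsto_slope_zero]
  refine (((T s).continuous.tendsto _).comp (tendsto_generator h)).congr fun t => ?_
  simp only [Function.comp_apply]
  rw [hT.map_add, ContinuousLinearMap.comp_apply, ← map_sub, ContinuousLinearMap.map_smul_of_tower]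

theorem IsC0Group.hasDerivAt_dilated_orbit (hT : IsC0Group T) {x : X}
    (h : x ∈ (generator T).domain) (t u s : ℝ) :
    HasDerivAt (fun s => T (t + u * (s - t)) x)
      (u • T (t + u * (s - t)) (pmapEval (generator T) x)) s := by
  have h1 : HasDerivAt (fun s : ℝ => t + u * (s - t)) u s := by
    simpa using (((hasDerivAt_id s).sub_const t).const_mul u).const_add t
  exact (hT.hasDerivAt_orbit h _).scomp s h1

/-- The uniform bound on the group makes the majorant `|w_n(s)(s - t)| M ‖Ax‖` independent of `u`.
-/
theorem IsC0Group.hasDerivAt_integral_dilated (hT : IsC0Group T) {M : ℝ}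
    (hM : ∀ t : ℝ, ‖T t‖ ≤ M) {x : X} (hx : x ∈ (generator T).domain) (n : ℕ) (t u : ℝ) :
    Integrable (fun s => (hermiteWeight n s * (s - t)) •
        T (t + u * (s - t)) (pmapEval (generator T) x)) ∧
    HasDerivAt (fun u => ∫ s, hermiteWeight n s • T (t + u * (s - t)) x)
      (∫ s, (hermiteWeight n s * (s - t)) • T (t + u * (s - t)) (pmapEval (generator T) x)) u := by
  have hw := continuous_hermiteWeight n
  have hi : Integrable fun s => hermiteWeight n s * (s - t) := by
    refine (integrable_hermiteWeight_mul_eval n (Polynomial.X - C t)).congr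
      (ae_of_all _ fun s => ?_)
    simp only [eval_sub, eval_X, eval_C]
  refine hasDerivAt_integral_of_dominated_loc_of_deriv_le (μ := volume)
    (F := fun u s => hermiteWeight n s • T (t + u * (s - t)) x)
    (F' := fun u s => (hermiteWeight n s * (s - t)) •
      T (t + u * (s - t)) (pmapEval (generator T) x))
    (bound := fun s => |hermiteWeight n s * (s - t)| * (M * ‖pmapEval (generator T) x‖))
    Filter.univ_mem ?_ ?_ ?_ ?_ (hi.abs.mul_const _) ?_
  · exact Eventually.of_forall fun v => (hw.smul ((hT.continuous_orbit x).comp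
      (by fun_prop : Continuous fun s => t + v * (s - t)))).aestronglyMeasurable
  · exact hT.integrable_hermiteWeight_smul hM n (by fun_prop) x
  · exact ((hw.mul (continuous_sub_right t)).smul ((hT.continuous_orbit _).comp
      (by fun_prop : Continuous fun s => t + u * (s - t)))).aestronglyMeasurable
  · refine ae_of_all _ fun s v _ => ?_
    rw [norm_smul]
    exact mul_le_mul_of_nonneg_left (norm_apply_le hM _ _) (abs_nonneg _)
  · refine ae_of_all _ fun s v _ => ?_
    have h1 : HasDerivAt (fun v : ℝ => t + v * (s - t)) (s - t) v := by
      simpa using ((hasDerivAt_id v).mul_const (s - t)).const_add t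
    exact (((hT.hasDerivAt_orbit hx _).scomp v h1).const_smul (hermiteWeight n s)).congr_deriv
      (smul_smul _ _ _)

theorem IsC0Group.hasDerivAt_dilatedSum (hT : IsC0Group T) {M : ℝ}
    (hM : ∀ t : ℝ, ‖T t‖ ≤ M) {x : X} (hx : x ∈ (generator T).domain) (m : ℕ) (t u : ℝ) :
    HasDerivAt (dilatedSum T m t x)
      (((√Real.pi)⁻¹ * (1 / (2 ^ (m + 1) * (m.factorial : ℝ)))) •
        ((hermitePoly m).eval t • (∫ s, hermiteWeight (m + 1) s •
            T (t + u * (s - t)) (pmapEval (generator T) x)) -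
          (hermitePoly (m + 1)).eval t • (∫ s, hermiteWeight m s •
            T (t + u * (s - t)) (pmapEval (generator T) x)))) u := by
  have hf : Continuous fun s : ℝ => t + u * (s - t) := by fun_prop
  refine ((HasDerivAt.fun_sum fun n _ => ((hT.hasDerivAt_integral_dilated hM hx n t u).2.const_smul
    (1 / (2 ^ n * (n.factorial : ℝ)) * (hermitePoly n).eval t))).const_smul
      (√Real.pi)⁻¹).congr_deriv ?_
  rw [mul_smul]
  congr 1
  set y := pmapEval (generator T) x
  have i1 : Integrable fun s => (hermitePoly m).eval t • hermiteWeight (m + 1) s •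
      T (t + u * (s - t)) y := (hT.integrable_hermiteWeight_smul hM (m + 1) hf y).smul _
  have i2 : Integrable fun s => (hermitePoly (m + 1)).eval t • hermiteWeight m s •
      T (t + u * (s - t)) y := (hT.integrable_hermiteWeight_smul hM m hf y).smul _
  have i3 : ∀ n ∈ Finset.range (m + 1), Integrable fun s =>
      (1 / (2 ^ n * (n.factorial : ℝ)) * (hermitePoly n).eval t) •
        (hermiteWeight n s * (s - t)) • T (t + u * (s - t)) y :=
    fun n _ => (hT.hasDerivAt_integral_dilated hM hx n t u).1.smul _
  simp only [← integral_smul]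
  rw [← integral_finsetSum _ i3, ← integral_sub i1 i2, ← integral_smul]
  refine integral_congr_ae (ae_of_all _ fun s => ?_)
  simp only [smul_smul, ← sub_smul, ← Finset.sum_smul]
  congr 1
  -- The factor `s - t` from the chain rule is the one on the left of Christoffel–Darboux, so all
  -- but the two top-index terms telescope.
  have h := congrArg (· * Real.exp (-s ^ 2)) (christoffel_darboux m t s)
  simp only [Finset.sum_mul] at h
  simp only [hermiteWeight]
  rw [show ∀ a b c d e f : ℝ, a * (b * (c * d) - e * (f * d)) = a * (b * c - e * f) * d by
    intros; ring, ← h]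
  refine Finset.sum_congr rfl fun n _ => ?_
  ring

variable [CompleteSpace X]

/-- The Gaussian-type averages `∫ Hₙ(s) e^{-s²} T(s) x ds` lie in the domain of the generator,
which raises the index `n` by one. -/
theorem IsC0Group.tendsto_integral_hermiteWeight (hT : IsC0Group T) {M : ℝ}
    (hM : ∀ t : ℝ, ‖T t‖ ≤ M) (n : ℕ) (x : X) :
    Tendsto (fun h : ℝ => h⁻¹ • (T h (∫ s, hermiteWeight n s • T s x) -
      ∫ s, hermiteWeight n s • T s x)) (𝓝[≠] 0) (𝓝 (∫ s, hermiteWeight (n + 1) s • T s x)) := by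
  -- The group law and translation invariance move `T(h)` onto the smooth weight, so no regularity
  -- of `x` is needed.
  have hsm : ∀ h : ℝ, T h (∫ s, hermiteWeight n s • T s x) =
      ∫ s, hermiteWeight n (s - h) • T s x := by
    intro h
    have e1 := (((T h).restrictScalars ℝ).integral_comp_comm
      (hT.integrable_hermiteWeight_smul hM n continuous_id x)).symm
    simp only [ContinuousLinearMap.coe_restrictScalars', id_eq,
      ContinuousLinearMap.map_smul_of_tower] at e1
    rw [e1, ← integral_sub_right_eq_self _ h]
    refine integral_congr_ae (ae_of_all _ fun s => ?_)
    simp only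
    rw [← ContinuousLinearMap.comp_apply, ← hT.map_add, add_sub_cancel]
  obtain ⟨g, hg, hgb⟩ := exists_abs_hermiteWeight_sub_le (n + 1)
  have hcont : Continuous fun s => T s x := hT.continuous_orbit x
  have hD := hasDerivAt_integral_of_dominated_loc_of_deriv_le (μ := volume)
    (F := fun h s => hermiteWeight n (s - h) • T s x)
    (F' := fun h s => hermiteWeight (n + 1) (s - h) • T s x)
    (bound := fun s => g s * (M * ‖x‖)) (x₀ := (0 : ℝ)) (Metric.closedBall_mem_nhds 0 one_pos)
    (Eventually.of_forall fun h => (((continuous_hermiteWeight n).comp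
      (continuous_sub_right h)).smul hcont).aestronglyMeasurable)
    (by simpa using hT.integrable_hermiteWeight_smul hM n continuous_id x)
    (((continuous_hermiteWeight (n + 1)).comp
      (continuous_sub_right 0)).smul hcont).aestronglyMeasurable
    (ae_of_all _ fun s h hh => by
      rw [norm_smul]
      have := hgb s h (by simpa using hh)
      exact mul_le_mul this (norm_apply_le hM s x) (norm_nonneg _) ((abs_nonneg _).trans this))
    (hg.mul_const _)
    (ae_of_all _ fun s h _ => by
      have h1 : HasDerivAt (fun h : ℝ => hermiteWeight n (s - h))
          (hermiteWeight (n + 1) (s - h)) h := by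
        refine ((hasDerivAt_hermiteWeight n (s - h)).comp h
          ((hasDerivAt_id h).const_sub s)).congr_deriv (by ring)
      exact h1.smul_const _)
  have := hasDerivAt_iff_tendsto_slope_zero.1 hD.2
  simp only [sub_zero, zero_add] at this
  simpa only [hsm] using this

/-- Membership holds for every `n`, so the default value `0` of `pmapEval` never enters the partial
sums. -/
theorem IsC0Group.pmapPow_generator_gaussSemigroup (hT : IsC0Group T) {M : ℝ}
    (hM : ∀ t : ℝ, ‖T t‖ ≤ M) (n : ℕ) (x : X) :
    gaussSemigroup T (1 / 4) x ∈ (pmapPow (generator T) n).domain ∧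
      pmapEval (pmapPow (generator T) n) (gaussSemigroup T (1 / 4) x) =
        (√Real.pi)⁻¹ • ∫ s, hermiteWeight n s • T s x := by
  induction n with
  | zero => exact ⟨Submodule.mem_top, by rw [pmapEval_pmapPow_zero, gaussSemigroup_quarter]⟩
  | succ n ih =>
    have h := ((hT.tendsto_integral_hermiteWeight hM n x).const_smul (√Real.pi)⁻¹).congr
      (f₂ := fun h : ℝ => h⁻¹ • (T h ((√Real.pi)⁻¹ • ∫ s, hermiteWeight n s • T s x) -
        (√Real.pi)⁻¹ • ∫ s, hermiteWeight n s • T s x)) fun h => by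
      rw [ContinuousLinearMap.map_smul_of_tower, ← smul_sub, smul_comm]
    have hmem : gaussSemigroup T (1 / 4) x ∈ (pmapPow (generator T) (n + 1)).domain :=
      mem_domain_pmapPow_succ_iff.2
        ⟨ih.1, by rw [ih.2]; exact mem_domain_generator_of_tendsto h⟩
    exact ⟨hmem, by rw [pmapEval_pmapPow_succ hmem, ih.2, pmapEval_generator_of_tendsto h]⟩

theorem IsC0Group.hermiteSum_eq (hT : IsC0Group T) {M : ℝ} (hM : ∀ t : ℝ, ‖T t‖ ≤ M) (m : ℕ)
    (t : ℝ) (x : X) :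
    hermiteSum T m t x = (√Real.pi)⁻¹ • ∑ n ∈ Finset.range (m + 1),
      (1 / (2 ^ n * (n.factorial : ℝ)) * (hermitePoly n).eval t) •
        ∫ s, hermiteWeight n s • T s x := by
  rw [hermiteSum, Finset.smul_sum]
  refine Finset.sum_congr rfl fun n _ => ?_
  rw [(hT.pmapPow_generator_gaussSemigroup hM n x).2, hermiteH_eq_eval, smul_comm]

/-- Repeated integration by parts along a dilated orbit. -/
theorem IsC0Group.integral_hermiteWeight_smul_pmapPow (hT : IsC0Group T) {M : ℝ}
    (hM : ∀ t : ℝ, ‖T t‖ ≤ M) (t u : ℝ) {p : ℕ} {x : X}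
    (hx : x ∈ (pmapPow (generator T) p).domain) (k j : ℕ) (hj : j ≤ p) :
    ∫ s, hermiteWeight (k + (p - j)) s •
        T (t + u * (s - t)) (pmapEval (pmapPow (generator T) j) x) =
      u ^ (p - j) • ∫ s, hermiteWeight k s •
        T (t + u * (s - t)) (pmapEval (pmapPow (generator T) p) x) := by
  -- Descending from `j = p`, each integration by parts trades one index of the weight for one power
  -- of `A`, at the cost of a chain-rule factor `u`.
  induction hj using Nat.decreasingInduction with
  | self => simp
  | of_succ j hj ih =>
    obtain ⟨d, rfl⟩ : ∃ d, p = j + 1 + d := ⟨p - (j + 1), by omega⟩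
    have hf : Continuous fun s : ℝ => t + u * (s - t) := by fun_prop
    have hx' := mem_domain_pmapPow_of_le (show j + 1 ≤ j + 1 + d by omega) hx
    have hd := (mem_domain_pmapPow_succ_iff.1 hx').2
    have e1 : k + (j + 1 + d - j) = k + d + 1 := by omega
    have e2 : j + 1 + d - j = d + 1 := by omega
    have e3 : j + 1 + d - (j + 1) = d := by omega
    rw [e3] at ih
    rw [e1, e2, integral_hermiteWeight_succ_smul (k + d)
      (fun s => hT.hasDerivAt_dilated_orbit hd t u s)
      (hT.integrable_hermiteWeight_smul hM _ hf _) (hT.integrable_hermiteWeight_smul hM _ hf _)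
      (by
        simp only [smul_comm _ u]
        exact (hT.integrable_hermiteWeight_smul hM _ hf _).smul u)]
    simp only [smul_comm _ u]
    rw [integral_smul, ← pmapEval_pmapPow_succ hx', ih, smul_smul, pow_succ']

theorem IsC0Group.dilatedSum_one (hT : IsC0Group T) {M : ℝ} (hM : ∀ t : ℝ, ‖T t‖ ≤ M) (m : ℕ)
    (t : ℝ) (x : X) : dilatedSum T m t x 1 = hermiteSum T m t x := by
  simp [hT.hermiteSum_eq hM, dilatedSum]

end Orbits

/-! ### Scalar estimates -/

theorem pow_mul_factorial_sub_le {m r : ℕ} (hr : r ≤ m) :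
    m ^ r * (m - r).factorial ≤ r.factorial * m.factorial := by
  induction r with
  | zero => simp
  | succ r ih =>
    have h1 : m - r = (m - (r + 1)) + 1 := by omega
    have ih' := ih (by omega)
    -- This factor-by-factor comparison is valid for every `r < m`; the price `r!` goes into the
    -- constant depending on `p`, so no lower bound on `m` in terms of `p` beyond `p ≤ m + 1`
    -- arises.
    have h2 : m ≤ (r + 1) * (m - r) := by
      obtain ⟨d, rfl⟩ : ∃ d, m = r + 1 + d := ⟨m - (r + 1), by omega⟩
      rw [show r + 1 + d - r = d + 1 by omega]
      nlinarith [Nat.zero_le (r * d)]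
    calc m ^ (r + 1) * (m - (r + 1)).factorial
        = m ^ r * (m - (r + 1)).factorial * m := by ring
      _ ≤ m ^ r * (m - (r + 1)).factorial * ((r + 1) * (m - r)) := by gcongr
      _ = (r + 1) * (m ^ r * (m - r).factorial) := by
        rw [h1, Nat.factorial_succ, ← h1]; ring
      _ ≤ (r + 1) * (r.factorial * m.factorial) := by gcongr
      _ = _ := by rw [Nat.factorial_succ r]; ring

/-- The decay in `m` of the scalar factor in the derivative of the dilated sum. -/
theorem hermite_coefficient_bound {m r : ℕ} (hm : 1 ≤ m) (hr : r ≤ m) (t : ℝ) :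
    1 / (2 ^ (m + 1) * (m.factorial : ℝ)) *
      (|(hermitePoly m).eval t| * √(2 ^ (m + 1 - r) * (m + 1 - r).factorial) +
        |(hermitePoly (m + 1)).eval t| * √(2 ^ (m - r) * (m - r).factorial)) ≤
      4 * Real.exp (t ^ 2) * √r.factorial / (m : ℝ) ^ ((r : ℝ) / 2 - 1 / 4) := by
  set D : ℝ := 2 ^ (m + 1) * (m.factorial : ℝ) with hD
  have hD0 : 0 < D := by positivity
  -- Common bound for both products: each squared is at most `D² b`. The gain `2^{-r}` is discarded,
  -- and `√(m + 1)` is `m + 1` from the factorials over the `√(m + 1)` of the pointwise bound.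
  set b : ℝ := 2 * Real.exp (2 * t ^ 2) * √(m + 1) * r.factorial / m ^ r with hb
  have hm0 : (0 : ℝ) < m := by exact_mod_cast hm
  have hfac : ((m - r).factorial : ℝ) ≤ r.factorial * m.factorial / m ^ r := by
    rw [le_div_iff₀ (by positivity), mul_comm]
    exact_mod_cast pow_mul_factorial_sub_le hr
  have hsq : (m + 1 : ℝ) / √(m + 1) = √(m + 1) := Real.div_sqrt
  have h2r : (2 : ℝ) ^ (m - r) ≤ 2 ^ m := pow_le_pow_right₀ one_le_two (Nat.sub_le _ _)
  have key1 : |(hermitePoly m).eval t| * √(2 ^ (m + 1 - r) * (m + 1 - r).factorial) ≤ D * √b := by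
    refine le_of_sq_le_sq ?_ (by positivity)
    rw [mul_pow, sq_abs, Real.sq_sqrt (by positivity), mul_pow, Real.sq_sqrt (by positivity)]
    have e : m + 1 - r = m - r + 1 := by omega
    have hle : ((m + 1 - r).factorial : ℝ) ≤ (m + 1) * (r.factorial * m.factorial / m ^ r) := by
      rw [e, Nat.factorial_succ]
      push_cast
      refine mul_le_mul ?_ hfac (by positivity) (by positivity)
      have : ((m - r : ℕ) : ℝ) ≤ m := by exact_mod_cast Nat.sub_le m r
      linarith
    calc _ ≤ (2 ^ m * m.factorial * (2 * Real.exp (2 * t ^ 2) / √(m + 1))) *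
          (2 ^ (m + 1) * ((m + 1) * (r.factorial * m.factorial / m ^ r))) := by
          refine mul_le_mul (sq_hermitePoly_le m t) (mul_le_mul ?_ hle ?_ ?_) ?_ ?_ <;>
            first | positivity | exact pow_le_pow_right₀ one_le_two (Nat.sub_le _ _)
      _ = 2 ^ m * 2 ^ (m + 1) * m.factorial ^ 2 * (2 * Real.exp (2 * t ^ 2) *
          ((m + 1) / √(m + 1)) * r.factorial / m ^ r) := by ring
      _ = 2 ^ m * 2 ^ (m + 1) * m.factorial ^ 2 * b := by rw [hsq]
      _ ≤ D ^ 2 * b := by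
        refine mul_le_mul_of_nonneg_right ?_ (by positivity)
        rw [hD, mul_pow, sq ((2 : ℝ) ^ (m + 1))]
        gcongr <;> simp
  have key2 : |(hermitePoly (m + 1)).eval t| * √(2 ^ (m - r) * (m - r).factorial) ≤ D * √b := by
    refine le_of_sq_le_sq ?_ (by positivity)
    rw [mul_pow, sq_abs, Real.sq_sqrt (by positivity), mul_pow, Real.sq_sqrt (by positivity)]
    calc _ ≤ (2 ^ (m + 1) * (m + 1).factorial * (2 * Real.exp (2 * t ^ 2) / √(m + 1))) *
          (2 ^ m * (r.factorial * m.factorial / m ^ r)) := by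
          refine mul_le_mul (sq_hermitePoly_succ_le m t) (mul_le_mul h2r hfac ?_ ?_) ?_ ?_ <;>
            positivity
      _ = 2 ^ m * 2 ^ (m + 1) * m.factorial ^ 2 * (2 * Real.exp (2 * t ^ 2) *
          ((m + 1) / √(m + 1)) * r.factorial / m ^ r) := by
          rw [Nat.factorial_succ]; push_cast; ring
      _ = 2 ^ m * 2 ^ (m + 1) * m.factorial ^ 2 * b := by rw [hsq]
      _ ≤ D ^ 2 * b := by
        refine mul_le_mul_of_nonneg_right ?_ (by positivity)
        rw [hD, mul_pow, sq ((2 : ℝ) ^ (m + 1))]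
        gcongr <;> simp
  have hbb : √b ≤ 2 * Real.exp (t ^ 2) * √r.factorial / (m : ℝ) ^ ((r : ℝ) / 2 - 1 / 4) := by
    rw [Real.sqrt_le_left (by positivity), div_pow, mul_pow, mul_pow, Real.sq_sqrt (by positivity),
      ← Real.exp_nat_mul, ← Real.rpow_natCast ((m : ℝ) ^ _), ← Real.rpow_mul hm0.le,
      show ((r : ℝ) / 2 - 1 / 4) * ((2 : ℕ) : ℝ) = r - 1 / 2 by push_cast; ring,
      Real.rpow_sub hm0, Real.rpow_natCast, ← Real.sqrt_eq_rpow, hb]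
    have h2 : √(m + 1 : ℝ) ≤ 2 * √m := by
      rw [Real.sqrt_le_left (by positivity), mul_pow, Real.sq_sqrt hm0.le]
      have : (1 : ℝ) ≤ m := by exact_mod_cast hm
      linarith
    calc _ ≤ 2 * Real.exp (2 * t ^ 2) * (2 * √m) * r.factorial / m ^ r := by gcongr
      _ = _ := by
        push_cast
        field_simp
  calc _ ≤ 1 / D * (D * √b + D * √b) := by gcongr
    _ = 2 * √b := by field_simp; ring
    _ ≤ 2 * (2 * Real.exp (t ^ 2) * √r.factorial / (m : ℝ) ^ ((r : ℝ) / 2 - 1 / 4)) := by gcongr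
    _ = _ := by ring

/-! ### The approximation rate -/

section Rate

variable {𝕜 X : Type*} [RCLike 𝕜] [NormedAddCommGroup X] [NormedSpace ℝ X] [NormedSpace 𝕜 X]
  [IsScalarTower ℝ 𝕜 X] [CompleteSpace X] {T : ℝ → X →L[𝕜] X}

/-- The approximation rate `m ^ (3 / 4 - p / 2)` for the Hermite expansion of an orbit. -/
theorem IsC0Group.norm_sub_hermiteSum_le (hT : IsC0Group T) {M : ℝ} (hM : ∀ t : ℝ, ‖T t‖ ≤ M)
    (t : ℝ) {m r : ℕ} (hm : 1 ≤ m) (hr : r ≤ m) {x : X}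
    (hx : x ∈ (pmapPow (generator T) (r + 1)).domain) :
    ‖T t x - hermiteSum T m t x‖ ≤
      4 * Real.exp (t ^ 2) * √r.factorial / (m : ℝ) ^ ((r : ℝ) / 2 - 1 / 4) *
        (M * ‖pmapEval (pmapPow (generator T) (r + 1)) x‖) := by
  have hM0 : 0 ≤ M := (norm_nonneg _).trans (hM 0)
  have hx1 := mem_domain_pmapPow_of_le (show 0 + 1 ≤ r + 1 by omega) hx
  have hxA : x ∈ (generator T).domain := by
    simpa only [pmapEval_pmapPow_zero] using (mem_domain_pmapPow_succ_iff.1 hx1).2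
  have hAx : pmapEval (pmapPow (generator T) 1) x = pmapEval (generator T) x := by
    simpa only [pmapEval_pmapPow_zero] using pmapEval_pmapPow_succ hx1
  set z := pmapEval (pmapPow (generator T) (r + 1)) x with hz
  -- The factor `u^r` from the integrations by parts is at most `1` on the segment.
  have hint : ∀ k, r ≤ k → ∀ u ∈ Set.Ico (0 : ℝ) 1,
      ‖∫ s, hermiteWeight k s • T (t + u * (s - t)) (pmapEval (generator T) x)‖ ≤
        √(2 ^ (k - r) * (k - r).factorial) * √Real.pi * (M * ‖z‖) := by
    intro k hk u hu
    have h := hT.integral_hermiteWeight_smul_pmapPow hM t u hx (k - r) 1 (by omega)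
    rw [hAx, Nat.add_sub_cancel, Nat.sub_add_cancel hk] at h
    rw [h, norm_smul, norm_pow, Real.norm_eq_abs, abs_of_nonneg hu.1]
    refine (mul_le_of_le_one_left (norm_nonneg _) (pow_le_one₀ hu.1 hu.2.le)).trans ?_
    exact norm_integral_hermiteWeight_smul_le hM (k - r) (fun s => t + u * (s - t)) _
  -- The two quantities are the endpoint values of the dilated sum, so the mean value inequality on
  -- `[0, 1]` applies.
  rw [norm_sub_rev, ← hT.dilatedSum_one hM, ← dilatedSum_zero T m t x]
  refine (norm_image_sub_le_of_norm_deriv_le_segment_01'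
    (fun u _ => (hT.hasDerivAt_dilatedSum hM hxA m t u).hasDerivWithinAt) fun u hu => ?_).trans
    (mul_le_mul_of_nonneg_right (hermite_coefficient_bound hm hr t) (by positivity))
  have hpi : 0 < √Real.pi := Real.sqrt_pos.2 Real.pi_pos
  rw [norm_smul, Real.norm_of_nonneg (by positivity)]
  calc _ ≤ (√Real.pi)⁻¹ * (1 / (2 ^ (m + 1) * (m.factorial : ℝ))) *
        (|(hermitePoly m).eval t| *
            (√(2 ^ (m + 1 - r) * (m + 1 - r).factorial) * √Real.pi * (M * ‖z‖)) +
          |(hermitePoly (m + 1)).eval t| *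
            (√(2 ^ (m - r) * (m - r).factorial) * √Real.pi * (M * ‖z‖))) := by
        refine mul_le_mul_of_nonneg_left ((norm_sub_le _ _).trans ?_) (by positivity)
        rw [norm_smul, norm_smul, Real.norm_eq_abs, Real.norm_eq_abs]
        gcongr
        · exact hint (m + 1) (by omega) u hu
        · exact hint m hr u hu
    _ = _ := by
        field_simp

/-- The rate on a bounded set of times, with an explicit constant. -/
theorem IsC0Group.norm_sub_hermiteSum_le_of_abs_le (hT : IsC0Group T) {M : ℝ}
    (hM : ∀ t : ℝ, ‖T t‖ ≤ M) {R t : ℝ} (ht : |t| ≤ R) {m p : ℕ} (hm : 1 ≤ m) (hp : 2 ≤ p)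
    (hpm : p ≤ m + 1) (x : (pmapPow (generator T) p).domain) :
    ‖T t (x : X) - hermiteSum T m t (x : X)‖ ≤
      4 * Real.exp (R ^ 2) * √(p - 1).factorial * M / (m : ℝ) ^ ((p : ℝ) / 2 - 11 / 12) *
        ‖pmapPow (generator T) p x‖ := by
  have hM0 : 0 ≤ M := (norm_nonneg _).trans (hM 0)
  obtain ⟨r, rfl⟩ : ∃ r, p = r + 1 := ⟨p - 1, by omega⟩
  have hm1 : (1 : ℝ) ≤ m := by exact_mod_cast hm
  have h := hT.norm_sub_hermiteSum_le hM t hm (show r ≤ m by omega) x.2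
  rw [pmapEval_of_mem x.2] at h
  refine h.trans ?_
  have ht2 : t ^ 2 ≤ R ^ 2 := sq_le_sq' (abs_le.1 ht).1 (abs_le.1 ht).2
  -- With `p = r + 1` the required exponent is `r/2 - 5/12`, below the proved `r/2 - 1/4`; as `m ≥
  -- 1`, the bound only weakens.
  have hexp : (m : ℝ) ^ (((r + 1 : ℕ) : ℝ) / 2 - 11 / 12) ≤ (m : ℝ) ^ ((r : ℝ) / 2 - 1 / 4) :=
    Real.rpow_le_rpow_of_exponent_le hm1 (by push_cast; linarith)
  calc _ ≤ 4 * Real.exp (R ^ 2) * √r.factorial / (m : ℝ) ^ (((r + 1 : ℕ) : ℝ) / 2 - 11 / 12) *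
        (M * ‖pmapPow (generator T) (r + 1) x‖) := by gcongr
    _ = _ := by
      rw [Nat.add_sub_cancel]
      ring

end Rate

end HermiteGroup

theorem theorem3p4 {𝕜 X : Type*} [RCLike 𝕜] [NormedAddCommGroup X] [NormedSpace ℝ X]
    [NormedSpace 𝕜 X] [IsScalarTower ℝ 𝕜 X] [CompleteSpace X]
    (T : ℝ → X →L[𝕜] X) (hT : HermiteGroup.IsC0Group T)
    (hbdd : ∃ M : ℝ, ∀ t : ℝ, ‖T t‖ ≤ M) :
    -- the terms `Aⁿ T^{(g)}(1/4) x` of the partial sums make sense for all `x`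
    (∀ (n : ℕ) (x : X), HermiteGroup.gaussSemigroup T (1 / 4) x ∈
        (HermiteGroup.pmapPow (HermiteGroup.generator T) n).domain) ∧
    -- the rate at each `t`, with `m₀` depending on `t` only and the constant on `t` and `p` only
    (∀ t : ℝ, ∃ (m₀ : ℕ) (C : ℕ → ℝ), ∀ m : ℕ, m₀ ≤ m → ∀ p : ℕ, 2 ≤ p → p ≤ m + 1 →
      ∀ x : (HermiteGroup.pmapPow (HermiteGroup.generator T) p).domain,
        ‖T t (x : X) - HermiteGroup.hermiteSum T m t (x : X)‖ ≤
          C p / (m : ℝ) ^ ((p : ℝ) / 2 - 11 / 12) *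
            ‖HermiteGroup.pmapPow (HermiteGroup.generator T) p x‖) ∧
    -- on a compact set of times, `m₀` and the constants can be chosen independently of `t`
    (∀ K : Set ℝ, IsCompact K → ∃ (m₀ : ℕ) (C : ℕ → ℝ), ∀ t ∈ K, ∀ m : ℕ, m₀ ≤ m →
      ∀ p : ℕ, 2 ≤ p → p ≤ m + 1 →
      ∀ x : (HermiteGroup.pmapPow (HermiteGroup.generator T) p).domain,
        ‖T t (x : X) - HermiteGroup.hermiteSum T m t (x : X)‖ ≤
          C p / (m : ℝ) ^ ((p : ℝ) / 2 - 11 / 12) *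
            ‖HermiteGroup.pmapPow (HermiteGroup.generator T) p x‖) ∧
    -- hence the convergence is locally uniform in `t`
    (∀ p : ℕ, 2 ≤ p → ∀ x : (HermiteGroup.pmapPow (HermiteGroup.generator T) p).domain,
      TendstoLocallyUniformly (fun (m : ℕ) (t : ℝ) => HermiteGroup.hermiteSum T m t (x : X))
        (fun t : ℝ => T t (x : X)) Filter.atTop)
  := by
  obtain ⟨M, hM⟩ := hbdd
  have hcpt : ∀ K : Set ℝ, IsCompact K → ∃ (m₀ : ℕ) (C : ℕ → ℝ), ∀ t ∈ K, ∀ m : ℕ, m₀ ≤ m →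
      ∀ p : ℕ, 2 ≤ p → p ≤ m + 1 →
      ∀ x : (HermiteGroup.pmapPow (HermiteGroup.generator T) p).domain,
        ‖T t (x : X) - HermiteGroup.hermiteSum T m t (x : X)‖ ≤
          C p / (m : ℝ) ^ ((p : ℝ) / 2 - 11 / 12) *
            ‖HermiteGroup.pmapPow (HermiteGroup.generator T) p x‖ := by
    intro K hK
    obtain ⟨R, hR⟩ := hK.isBounded.exists_norm_le
    -- `m₀ = 1` suffices; `t` enters only through `e^{t²} ≤ e^{R²}`.
    exact ⟨1, fun p => 4 * Real.exp (R ^ 2) * √(p - 1).factorial * M, fun t ht m hm p hp hpm x =>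
      hT.norm_sub_hermiteSum_le_of_abs_le hM (hR t ht) hm hp hpm x⟩
  refine ⟨fun n x => (hT.pmapPow_generator_gaussSemigroup hM n x).1, fun t => ?_, hcpt,
    fun p hp x => ?_⟩
  · obtain ⟨m₀, C, h⟩ := hcpt {t} isCompact_singleton
    exact ⟨m₀, C, h t rfl⟩
  · rw [tendstoLocallyUniformly_iff_forall_isCompact]
    intro K hK
    obtain ⟨m₀, C, h⟩ := hcpt K hK
    -- For `p ≥ 2` the exponent is at least `1/12`.
    have hexp : 0 < (p : ℝ) / 2 - 11 / 12 := by
      have : (2 : ℝ) ≤ p := by exact_mod_cast hp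
      linarith
    have hlim : Tendsto (fun m : ℕ => C p / (m : ℝ) ^ ((p : ℝ) / 2 - 11 / 12) *
        ‖HermiteGroup.pmapPow (HermiteGroup.generator T) p x‖) atTop (𝓝 0) := by
      simpa using (((tendsto_rpow_atTop hexp).comp tendsto_natCast_atTop_atTop).const_div_atTop
        (C p)).mul_const ‖HermiteGroup.pmapPow (HermiteGroup.generator T) p x‖
    rw [Metric.tendstoUniformlyOn_iff]
    intro ε hε
    -- The estimate requires `p ≤ m + 1`, hence the condition `m ≥ p`.
    filter_upwards [hlim.eventually_lt_const hε, eventually_ge_atTop m₀, eventually_ge_atTop p]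
      with m hm1 hm2 hm3 t ht
    rw [dist_eq_norm]
    exact (h t ht m hm2 p hp (by omega) x).trans_lt hm1
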